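/- Let $G$ be a forest (a finite simple graph without cycles) with vertices $1,\dots,n$, let $K$ be a field, and let $G^*$ be the whisker graph of $G$, that is, the graph on the vertices $1,\dots,n,1',\dots,n'$ whose edges are the edges of $G$ together with $\{1,1'\},\dots,\{n,n'\}$. Let $S^*=K[x_1,\dots,x_n,y_1,\dots,y_n]$ and let $$I(G^*)=\bigl(x_ix_j : \{i,j\}\in E(G)\bigr)+\bigl(x_1y_1,\dots,x_ny_n\bigr)\subset S^*$$ be the edge ideal of $G^*$. Then $$\operatorname{depth}\bigl(S^*/I(G^*)^k\bigr)\ \ge\ n-k+1\qquad\text{for } k=1,\dots,n,$$ where $\operatorname{depth}(M)$ denotes the maximal length of an $M$-regular sequence in the graded maximal ideal $(x_1,\dots,x_n,y_1,\dots,y_n)$ of $S^*$. -/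

import Mathlib

/-- The adjacency relation of the whisker graph: the vertices of `G` are `Sum.inl i`, and the new
vertex attached to `i` is `Sum.inr i`. -/
def whiskerAdj {V : Type*} (G : SimpleGraph V) : V ⊕ V → V ⊕ V → Prop
  | Sum.inl i, Sum.inl j => G.Adj i j
  | Sum.inl i, Sum.inr j => i = j
  | Sum.inr i, Sum.inl j => i = j
  | Sum.inr _, Sum.inr _ => False

/-- The whisker graph `G*` of `G`: to each vertex `i` of `G` one attaches a new vertex `i'` by
the new edge `{i, i'}`. -/
def whiskerGraph {V : Type*} (G : SimpleGraph V) : SimpleGraph (V ⊕ V) where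
  Adj := whiskerAdj G
  symm := ⟨by
    rintro (i | i) (j | j) h
    · exact SimpleGraph.Adj.symm h
    · exact Eq.symm h
    · exact Eq.symm h
    · exact h⟩
  loopless := ⟨by
    rintro (i | i) h
    · exact G.irrefl h
    · exact h⟩

/-- The edge ideal of a graph `H` over `K`: the ideal of the polynomial ring in the vertices of `H`
generated by the products `x_a x_b` over the edges `{a, b}` of `H`. -/
noncomputable def edgeIdeal (K : Type*) [Field K] {W : Type*} (H : SimpleGraph W) :
    Ideal (MvPolynomial W K) :=
  Ideal.span {f | ∃ a b : W, H.Adj a b ∧ f = MvPolynomial.X a * MvPolynomial.X b}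

/-- The depth of an `R`-module `M` with respect to an ideal `m` of `R`: the supremum of the lengths
of the `M`-regular sequences of elements of `m`, where a regular sequence `rs` is required to
satisfy `M ≠ rs M`. For a nonzero finitely generated graded module `M` over a polynomial ring in
finitely many variables over a field, the depth of `M` is its depth with respect to the graded
maximal ideal, which is the ideal generated by the variables. -/
noncomputable def moduleDepth {R : Type*} [CommRing R] (m : Ideal R) (M : Type*) [AddCommGroup M]
    [Module R M] : ℕ∞ :=
  sSup {d : ℕ∞ | ∃ rs : List R,
    (∀ r ∈ rs, r ∈ m) ∧ RingTheory.Sequence.IsRegular M rs ∧ d = (rs.length : ℕ∞)}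

/-! Depth is measured by the vanishing of `Ext^i(R/m, R/J)`, which passes from `J : f` and `J + (f)`
to `J` along `0 → R/(J : f) → R/J → R/(J + (f)) → 0`; Rees's theorem turns it back into a regular
sequence. All ideals that occur are monomial, so colons and sums become operations on sets of
exponent vectors.

The bound is proved for a larger class, closed under the deletions needed: ideals `I(H)^k + (x_a : a
∈ A)` where the forest `H` has a core `C` whose non-isolated vertices carry leaves. The claim is
depth at least `|C| + 1 - k`, by induction on the number of edges plus `k`. Take a core vertex `n`
with a leaf `y` and at most one core neighbour. Since `y` is a leaf, `I^k : x_n x_y = I^(k-1)`, and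
one power is gained. It remains to treat `I^k + (x_n x_y)`, by splitting along `y` or `x_n`.
Deleting `n` costs no core size, because the freed leaf `y` takes its place. Deleting `y` is
harmless if `n` keeps another leaf or becomes isolated. Otherwise `n` turns into a leaf at its core
neighbour `m`, and the lost core vertex is recovered by a further splitting along `x_m`
(`IsWhiskered.extVanishes`). -/

/-! ### Depth through the vanishing of Ext -/

/-- Multiplication by `f`, as a map `R/J₁ → R/J` where `f J₁ ⊆ J`. -/
def quotientMulMap {R : Type*} [CommRing R] {J₁ J : Ideal R} (f : R)
    (h : ∀ r ∈ J₁, f * r ∈ J) : (R ⧸ J₁) →ₗ[R] (R ⧸ J) :=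
  Submodule.mapQ J₁ J (LinearMap.lsmul R R f) (fun r hr => by simpa using h r hr)

open CategoryTheory Abelian in
/-- The short exact sequence `0 → R/(J : f) → R/J → R/(J + (f)) → 0`. -/
theorem exists_shortExact_colon {R : Type*} [CommRing R]
    {J J₁ J₂ : Ideal R} (f : R) (h₁ : ∀ r, r ∈ J₁ ↔ f * r ∈ J) (h₂ : J₂ = J ⊔ Ideal.span {f}) :
    ∃ (g : ModuleCat.of R (R ⧸ J) ⟶ ModuleCat.of R (R ⧸ J₂))
      (h : ModuleCat.ofHom (quotientMulMap f fun r hr => (h₁ r).1 hr) ≫ g = 0),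
      (ShortComplex.mk _ g h).ShortExact := by
  subst h₂
  let φ := quotientMulMap f fun r hr => (h₁ r).1 hr
  have hle : J ≤ J ⊔ Ideal.span {f} := le_sup_left
  let π : (R ⧸ J) →ₗ[R] (R ⧸ (J ⊔ Ideal.span {f})) := Submodule.factor hle
  have hex : Function.Exact φ π := by
    intro x
    obtain ⟨x, rfl⟩ := Submodule.mkQ_surjective _ x
    have : π (J.mkQ x) = (J ⊔ Ideal.span {f}).mkQ x := rfl
    rw [this, Submodule.mkQ_apply, Submodule.Quotient.mk_eq_zero, Submodule.mem_sup]
    constructor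
    · rintro ⟨a, ha, b, hb, rfl⟩
      obtain ⟨c, rfl⟩ := Ideal.mem_span_singleton'.1 hb
      refine ⟨J₁.mkQ c, (Submodule.Quotient.eq J).2 ?_⟩
      have : f * c - (a + c * f) = -a := by ring
      simpa [this] using ha
    · rintro ⟨c, hc⟩
      obtain ⟨c, rfl⟩ := Submodule.mkQ_surjective _ c
      have hc' : f * c - x ∈ J := (Submodule.Quotient.eq J).1 hc
      exact ⟨_, neg_mem hc', f * c, Ideal.mul_mem_right _ _ (Ideal.mem_span_singleton_self f),
        by ring⟩
  have hinj : Function.Injective φ := by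
    rw [← LinearMap.ker_eq_bot, LinearMap.ker_eq_bot']
    intro x hx
    obtain ⟨x, rfl⟩ := Submodule.mkQ_surjective _ x
    have hx' : f * x ∈ J := (Submodule.Quotient.mk_eq_zero J).1 hx
    exact (Submodule.Quotient.mk_eq_zero J₁).2 ((h₁ x).2 hx')
  exact ⟨ModuleCat.ofHom π, (ModuleCat.shortComplexOfCompEqZero φ π hex.linearMap_comp_eq_zero).zero,
    { exact := ModuleCat.shortComplex_exact
        (ModuleCat.shortComplexOfCompEqZero φ π hex.linearMap_comp_eq_zero) hex
      mono_f := (ModuleCat.mono_iff_injective _).2 hinj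
      epi_g := (ModuleCat.epi_iff_surjective _).2 (Submodule.factor_surjective hle) }⟩

/-- `ExtVanishes m J d` says that `Ext^i(R/m, R/J)` vanishes for all `i < d`. -/
def ExtVanishes {R : Type*} [CommRing R] (m J : Ideal R) (d : ℕ) : Prop :=
  ∀ i < d, Subsingleton
    (CategoryTheory.Abelian.Ext (ModuleCat.of R (R ⧸ m)) (ModuleCat.of R (R ⧸ J)) i)

namespace ExtVanishes

variable {R : Type*} [CommRing R] {m J : Ideal R} {d : ℕ}

theorem mono {e : ℕ} (h : ExtVanishes m J d) (hed : e ≤ d) : ExtVanishes m J e :=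
  fun i hi => h i (hi.trans_le hed)

open CategoryTheory Abelian in
theorem top : ExtVanishes m ⊤ d := by
  intro i _
  have : Subsingleton (R ⧸ (⊤ : Ideal R)) := Ideal.Quotient.subsingleton_iff.2 rfl
  have hz := ModuleCat.isZero_of_subsingleton (ModuleCat.of R (R ⧸ (⊤ : Ideal R)))
  refine subsingleton_of_forall_eq 0 fun y => ?_
  rw [← Ext.comp_mk₀_id y, hz.eq_of_src (𝟙 _) 0, Ext.mk₀_zero, Ext.comp_zero]

open CategoryTheory Abelian in
/-- The depth lemma for the exact sequence `0 → R/(J : f) → R/J → R/(J + (f)) → 0`. -/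
theorem of_colon {J₁ J₂ : Ideal R} (f : R) (h₁ : ∀ r, r ∈ J₁ ↔ f * r ∈ J)
    (h₂ : J₂ = J ⊔ Ideal.span {f}) (e₁ : ExtVanishes m J₁ d) (e₂ : ExtVanishes m J₂ d) :
    ExtVanishes m J d := by
  intro i hi
  obtain ⟨g, h, hS⟩ := exists_shortExact_colon f h₁ h₂
  refine subsingleton_of_forall_eq 0 fun x => ?_
  obtain ⟨y, hy⟩ := Ext.covariant_sequence_exact₂ _ hS (n := i) x ((e₂ i hi).elim _ _)
  have : y = 0 := (e₁ i hi).elim _ _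
  rw [← hy, this, Ext.zero_comp]

-- Multiplication by `f` is injective on `R/J`, but induces zero on `Ext(R/m, -)` because `f ∈ m`.
-- Hence the connecting map from `Ext^(i-1)` of `R/J₂` is onto `Ext^i` of `R/J`; for `i = 0`,
-- injectivity alone suffices.
open CategoryTheory Abelian in
theorem succ_of_regular {J₂ : Ideal R} {f : R} (hf : f ∈ m) (h₁ : ∀ r, f * r ∈ J → r ∈ J)
    (h₂ : J₂ = J ⊔ Ideal.span {f}) (e : ExtVanishes m J₂ d) : ExtVanishes m J (d + 1) := by
  intro i hi
  have h₁' : ∀ r, r ∈ J ↔ f * r ∈ J := fun r => ⟨fun hr => J.mul_mem_left f hr, h₁ r⟩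
  obtain ⟨g, h, hS⟩ := exists_shortExact_colon f h₁' h₂
  have hsmul : ModuleCat.ofHom (quotientMulMap f fun r hr => (h₁' r).1 hr) =
      f • 𝟙 (ModuleCat.of R (R ⧸ J)) := by
    ext
    simp [quotientMulMap]
    rfl
  have hf' : f ∈ Module.annihilator R (ModuleCat.of R (R ⧸ m)) := by
    rw [Ideal.annihilator_quotient]
    exact hf
  have hzero := Ext.postcomp_smul_id_eq_zero_of_mem_annihilator
    (M := ModuleCat.of R (R ⧸ J)) hf' i
  rw [← hsmul] at hzero
  refine subsingleton_of_forall_eq 0 fun y => ?_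
  have hy := congrArg (fun g => (ConcreteCategory.hom g) y) hzero
  cases i with
  | zero =>
    have := hS.mono_f
    exact Ext.postcomp_mk₀_injective_of_mono _ _ (hy.trans (map_zero _).symm)
  | succ n =>
    obtain ⟨z, hz⟩ := Ext.covariant_sequence_exact₁ _ hS y hy (n₀ := n) rfl
    have : z = 0 := (e n (by omega)).elim _ _
    rw [← hz, this, Ext.zero_comp]

/-- Rees's theorem: it needs `m (R/J) ≠ R/J`, which follows from `J ≤ m ≠ ⊤`, and a test module with
support `V(m)`, here `R/m`. -/
theorem le_moduleDepth [IsNoetherianRing R] (hm : m ≠ ⊤) (hJ : J ≤ m) (h : ExtVanishes m J d) :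
    (d : ℕ∞) ≤ moduleDepth m (R ⧸ J) := by
  have hlt : m • (⊤ : Submodule R (R ⧸ J)) < ⊤ := by
    rw [lt_top_iff_ne_top]
    intro heq
    have : J.mkQ 1 ∈ m • (⊤ : Submodule R (R ⧸ J)) := by rw [heq]; trivial
    rw [← Submodule.range_mkQ J, ← Submodule.map_top, ← Submodule.map_smul'',
      Ideal.smul_eq_mul, Ideal.mul_top, ← Submodule.mem_comap, Submodule.comap_map_mkQ,
      sup_eq_right.2 hJ] at this
    exact hm ((Ideal.eq_top_iff_one m).2 this)
  have hsupp : Module.support R (R ⧸ m) = PrimeSpectrum.zeroLocus m := by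
    rw [Module.support_eq_zeroLocus, Ideal.annihilator_quotient]
  obtain ⟨rs, hlen, hmem, hreg⟩ := ModuleCat.exists_isRegular_of_exists_subsingleton_ext m d
    (ModuleCat.of R (R ⧸ J)) hlt (ModuleCat.of R (R ⧸ m)) hsupp h
  exact le_sSup ⟨rs, hmem, hreg, by rw [hlen]⟩

end ExtVanishes

/-! ### Monomials in powers of an edge ideal -/

/-- `EdgePow H k s` says that the monomial with exponent vector `s` lies in the `k`-th power of the
edge ideal of `H`, i.e. it is divisible by a product of `k` edges. -/
inductive EdgePow {σ : Type*} (H : SimpleGraph σ) : ℕ → (σ →₀ ℕ) → Prop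
  | zero (s : σ →₀ ℕ) : EdgePow H 0 s
  | succ {k : ℕ} {s : σ →₀ ℕ} {a b : σ} (h : H.Adj a b) (hs : EdgePow H k s) :
      EdgePow H (k + 1) (s + (Finsupp.single a 1 + Finsupp.single b 1))

namespace EdgePow

open Finsupp

variable {σ : Type*} {H H' : SimpleGraph σ} {k : ℕ} {s t : σ →₀ ℕ}

/-- The edges of a product dividing a monomial join vertices of its support, so only those edges
have to be in `H'`. -/
theorem of_adj (h : EdgePow H k s)
    (hH : ∀ a b, H.Adj a b → s a ≠ 0 → s b ≠ 0 → H'.Adj a b) : EdgePow H' k s := by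
  classical
  induction h with
  | zero s => exact .zero s
  | succ hab _ ih =>
    refine .succ (hH _ _ hab (by simp) (by simp)) (ih fun c d hcd hc hd => hH c d hcd ?_ ?_)
    · simp only [coe_add, Pi.add_apply]; omega
    · simp only [coe_add, Pi.add_apply]; omega

theorem mono (h : EdgePow H k s) (hH : H ≤ H') : EdgePow H' k s :=
  h.of_adj fun _ _ hab _ _ => hH hab

theorem add_right (h : EdgePow H k s) (t : σ →₀ ℕ) : EdgePow H k (s + t) := by
  induction h with
  | zero s => exact .zero _
  | succ hab _ ih =>
    rw [add_right_comm]
    exact .succ hab ih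

theorem isUpperSet : IsUpperSet {s | EdgePow H k s} := by
  intro s t hst hs
  obtain ⟨u, rfl⟩ := exists_add_of_le hst
  exact add_right hs u

/-- A variable whose vertex is isolated can be dropped. -/
theorem of_add_single_of_isolated {y : σ} (hy : ∀ a, ¬ H.Adj y a)
    (h : EdgePow H k (s + single y 1)) : EdgePow H k s := by
  classical
  generalize hu : s + single y 1 = u at h
  induction h generalizing s with
  | zero u => exact .zero s
  | @succ k u a b hab _ ih =>
    have hya : y ≠ a := by rintro rfl; exact hy _ hab
    have hyb : y ≠ b := by rintro rfl; exact hy _ hab.symm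
    have huy : single y 1 ≤ u := by
      have := DFunLike.congr_fun hu y
      simp only [coe_add, Pi.add_apply, single_eq_same, single_eq_of_ne hya,
        single_eq_of_ne hyb] at this
      simp only [single_le_iff]
      omega
    obtain ⟨v, rfl⟩ := le_iff_exists_add'.1 huy
    have : s = v + (single a 1 + single b 1) := by
      apply add_right_cancel (b := single y 1)
      rw [hu, add_right_comm]
    rw [this]
    exact .succ hab (ih rfl)

/-- If every neighbour of `y` is a neighbour of `b`, then one may replace `y` by `b`. -/
theorem replace {y b : σ} (hyb : ∀ a, H.Adj y a → H.Adj b a)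
    (h : EdgePow H k (s + single y 1)) : EdgePow H k (s + single b 1) := by
  classical
  generalize hu : s + single y 1 = u at h
  induction h generalizing s with
  | zero u => exact .zero _
  | @succ k u c d hcd hk ih =>
    by_cases hyc : y = c
    · subst hyc
      have : s = u + single d 1 := by
        apply add_right_cancel (b := single y 1)
        rw [hu, add_assoc, add_comm (single d 1)]
      rw [this, add_assoc, add_comm (single d 1)]
      exact .succ (hyb _ hcd) hk
    by_cases hyd : y = d
    · subst hyd
      have : s = u + single c 1 := by
        apply add_right_cancel (b := single y 1)
        rw [hu, add_assoc]
      rw [this, add_assoc, add_comm (single c 1)]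
      exact .succ (hyb _ hcd.symm) hk
    have huy : single y 1 ≤ u := by
      have := DFunLike.congr_fun hu y
      simp only [coe_add, Pi.add_apply, single_eq_same, single_eq_of_ne hyc,
        single_eq_of_ne hyd] at this
      simp only [single_le_iff]
      omega
    obtain ⟨v, rfl⟩ := le_iff_exists_add'.1 huy
    have : s = v + (single c 1 + single d 1) := by
      apply add_right_cancel (b := single y 1)
      rw [hu, add_right_comm]
    rw [this, add_right_comm]
    exact .succ hcd (ih rfl)

/-- Cancelling the edge at a leaf `y` with neighbour `n`: `I^(k+1) : x_n x_y = I^k`. -/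
theorem of_add_leaf {n y : σ} (hy : ∀ a, H.Adj y a → a = n) (hny : H.Adj n y)
    (h : EdgePow H (k + 1) (s + (single n 1 + single y 1))) : EdgePow H k s := by
  classical
  have hne : n ≠ y := hny.ne
  generalize hu : s + (single n 1 + single y 1) = u at h
  generalize hK : k + 1 = K at h
  induction h generalizing s k with
  | zero u => simp at hK
  | @succ k' u c d hcd hk ih =>
    obtain rfl : k = k' := by omega
    -- The removed edge is `{n, b}`. If `b ≠ y`, the factor `y` lies in the rest `u`, where it can
    -- be exchanged for `b`, since its only neighbour `n` is also adjacent to `b`.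
    have edge : ∀ b, u + (single n 1 + single b 1) = s + (single n 1 + single y 1) →
        H.Adj n b → EdgePow H k s := by
      intro b hb hnb
      by_cases hyb : y = b
      · subst hyb
        rwa [← add_right_cancel hb]
      have hb' : u + single b 1 = s + single y 1 := by
        apply add_right_cancel (b := single n 1)
        rw [add_assoc, add_assoc, add_comm _ (single n 1), hb, add_comm (single n 1)]
      have huy : single y 1 ≤ u := by
        have := DFunLike.congr_fun hb' y
        simp only [coe_add, Pi.add_apply, single_eq_same, single_eq_of_ne hyb] at this
        simp only [single_le_iff]
        omega
      obtain ⟨v, rfl⟩ := le_iff_exists_add'.1 huy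
      have : s = v + single b 1 := by
        apply add_right_cancel (b := single y 1)
        rw [← hb', add_right_comm]
      rw [this]
      exact hk.replace fun a ha => by rw [hy a ha]; exact hnb.symm
    by_cases hnc : n = c
    · subst hnc
      exact edge d hu.symm hcd
    by_cases hnd : n = d
    · subst hnd
      exact edge c (by rw [add_comm (single n 1), hu]) hcd.symm
    -- An edge avoiding `n` also avoids the leaf `y`, so `x_n x_y` divides the rest and induction
    -- applies there.
    have hyc : y ≠ c := by rintro rfl; exact hnd (hy _ hcd).symm
    have hyd : y ≠ d := by rintro rfl; exact hnc (hy _ hcd.symm).symm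
    have huy : single n 1 + single y 1 ≤ u := by
      intro z
      have := DFunLike.congr_fun hu z
      simp only [coe_add, Pi.add_apply, single_apply] at this ⊢
      grind
    obtain ⟨v, rfl⟩ := le_iff_exists_add'.1 huy
    have hs : s = v + (single c 1 + single d 1) := by
      apply add_right_cancel (b := single n 1 + single y 1)
      rw [hu, add_right_comm]
    cases k with
    | zero => exact .zero s
    | succ k =>
      rw [hs]
      exact .succ hcd (ih rfl rfl)

end EdgePow

/-! ### Monomial ideals as upper sets of exponents -/

/-- The ideal generated by the monomials with exponent vectors in `T`. -/
noncomputable def monomialIdeal {σ : Type*} (K : Type*) [Field K] (T : Set (σ →₀ ℕ)) :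
    Ideal (MvPolynomial σ K) :=
  Ideal.span ((fun s => MvPolynomial.monomial s (1 : K)) '' T)

section MonomialIdeal

open MvPolynomial

variable {σ : Type*} {K : Type*} [Field K] {T : Set (σ →₀ ℕ)}

theorem mem_monomialIdeal (hT : IsUpperSet T) {f : MvPolynomial σ K} :
    f ∈ monomialIdeal K T ↔ ∀ s ∈ f.support, s ∈ T := by
  rw [monomialIdeal, mem_ideal_span_monomial_image]
  exact forall₂_congr fun s _ => ⟨fun ⟨t, ht, hts⟩ => hT hts ht, fun h => ⟨s, h, le_rfl⟩⟩

theorem isUpperSet_setOf_add_mem (hT : IsUpperSet T) (e : σ →₀ ℕ) :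
    IsUpperSet {s | s + e ∈ T} :=
  fun _ _ hst hs => hT (add_le_add_left hst e) hs

theorem mem_monomialIdeal_colon (hT : IsUpperSet T) (e : σ →₀ ℕ) (f : MvPolynomial σ K) :
    f ∈ monomialIdeal K {s | s + e ∈ T} ↔ monomial e 1 * f ∈ monomialIdeal K T := by
  rw [mem_monomialIdeal hT, mem_monomialIdeal (isUpperSet_setOf_add_mem hT e)]
  constructor
  · intro h s hs
    rw [mem_support_iff, coeff_monomial_mul'] at hs
    split_ifs at hs with hes
    · obtain ⟨t, rfl⟩ := le_iff_exists_add'.1 hes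
      exact h t (by simpa using hs)
    · exact absurd rfl hs
  · intro h s hs
    refine h (s + e) ?_
    rw [mem_support_iff, add_comm, coeff_monomial_mul]
    simpa using hs

theorem monomialIdeal_union_Ici (e : σ →₀ ℕ) :
    monomialIdeal K (T ∪ Set.Ici e) = monomialIdeal K T ⊔ Ideal.span {monomial e 1} := by
  rw [monomialIdeal, Set.image_union, Ideal.span_union, ← monomialIdeal]
  congr 1
  apply le_antisymm
  · rw [Ideal.span_le]
    rintro _ ⟨s, hs, rfl⟩
    obtain ⟨t, rfl⟩ := le_iff_exists_add'.1 (Set.mem_Ici.1 hs)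
    refine Ideal.mem_span_singleton'.2 ⟨monomial t 1, ?_⟩
    simp [monomial_mul]
  · rw [Ideal.span_le, Set.singleton_subset_iff]
    exact Ideal.subset_span ⟨e, Set.mem_Ici.2 le_rfl, rfl⟩

/-- The depth lemma on exponents: the colon is a shift and the sum a union with a principal upper
set, so each later ideal identity is an equality of sets. -/
theorem ExtVanishes.monomial_of_colon {T₁ T₂ : Set (σ →₀ ℕ)} {m : Ideal (MvPolynomial σ K)}
    {d : ℕ} (hT : IsUpperSet T) (e : σ →₀ ℕ) (h₁ : {s | s + e ∈ T} = T₁)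
    (h₂ : T ∪ Set.Ici e = T₂) (e₁ : ExtVanishes m (monomialIdeal K T₁) d)
    (e₂ : ExtVanishes m (monomialIdeal K T₂) d) : ExtVanishes m (monomialIdeal K T) d := by
  subst h₁ h₂
  exact of_colon (monomial e 1) (mem_monomialIdeal_colon hT e) (monomialIdeal_union_Ici e) e₁ e₂

theorem isUpperSet_setOf_exists_ne_zero (A : Set σ) :
    IsUpperSet {s : σ →₀ ℕ | ∃ a ∈ A, s a ≠ 0} := by
  rintro s t hst ⟨a, ha, hs⟩
  exact ⟨a, ha, fun h => hs (Nat.le_zero.1 (h ▸ hst a))⟩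

theorem setOf_exists_ne_zero_union_Ici (A : Set σ) (x : σ) :
    {s : σ →₀ ℕ | ∃ a ∈ A, s a ≠ 0} ∪ Set.Ici (Finsupp.single x 1) =
      {s | ∃ a ∈ insert x A, s a ≠ 0} := by
  ext s
  simp [Nat.one_le_iff_ne_zero, or_comm]

/-- The quotient by an ideal generated by variables has depth at least the number of the remaining
variables. -/
theorem extVanishes_variables (B : Finset σ) (A : Set σ) (hAB : ∀ b ∈ B, b ∉ A) :
    ExtVanishes (idealOfVars σ K) (monomialIdeal K {s | ∃ a ∈ A, s a ≠ 0}) B.card := by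
  classical
  induction B using Finset.induction_on generalizing A with
  | empty => exact fun i hi => absurd hi (by simp)
  | insert x B hx ih =>
    rw [Finset.card_insert_of_notMem hx]
    have hxA : x ∉ A := hAB x (Finset.mem_insert_self x B)
    refine ExtVanishes.succ_of_regular (f := monomial (Finsupp.single x 1) 1)
      (J₂ := monomialIdeal K {s | ∃ a ∈ insert x A, s a ≠ 0})
      (Ideal.subset_span ⟨x, rfl⟩) (fun r hr => ?_) ?_ (ih _ fun b hb => ?_)
    · rw [← mem_monomialIdeal_colon (isUpperSet_setOf_exists_ne_zero A)] at hr
      convert hr using 3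
      ext s
      refine exists_congr fun a => and_congr_right fun ha => ?_
      have : a ≠ x := by rintro rfl; exact hxA ha
      simp [Finsupp.single_eq_of_ne this]
    · rw [← monomialIdeal_union_Ici, setOf_exists_ne_zero_union_Ici]
    · rintro (rfl | h)
      · exact hx hb
      · exact hAB b (Finset.mem_insert_of_mem hb) h

/-- Powers of edge ideals are monomial ideals, described by `EdgePow`. -/
theorem edgeIdeal_pow (H : SimpleGraph σ) (k : ℕ) :
    edgeIdeal K H ^ k = monomialIdeal K {s | EdgePow H k s} := by
  induction k with
  | zero =>
    rw [pow_zero, Ideal.one_eq_top, eq_comm, Ideal.eq_top_iff_one]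
    exact Ideal.subset_span ⟨0, .zero 0, rfl⟩
  | succ k ih =>
    rw [pow_succ, ih]
    unfold monomialIdeal edgeIdeal
    rw [Ideal.span_mul_span']
    congr 1
    ext f
    have hX : ∀ a b : σ, (X a * X b : MvPolynomial σ K) =
        monomial (Finsupp.single a 1 + Finsupp.single b 1) 1 := fun a b => by
      simp [X, monomial_mul]
    constructor
    · rintro ⟨_, ⟨s, hs, rfl⟩, _, ⟨a, b, hab, rfl⟩, rfl⟩
      exact ⟨_, .succ hab hs, by simp [hX, monomial_mul]⟩
    · rintro ⟨_, hs, rfl⟩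
      cases hs with
      | succ hab hs =>
        exact ⟨_, ⟨_, hs, rfl⟩, _, ⟨_, _, hab, rfl⟩, by simp [hX, monomial_mul]⟩

end MonomialIdeal

/-! ### Whiskered forests and vertex deletion -/

/-- The graph obtained from `H` by deleting all edges at the vertex `x`. -/
def SimpleGraph.isolate {σ : Type*} (H : SimpleGraph σ) (x : σ) : SimpleGraph σ where
  Adj a b := H.Adj a b ∧ a ≠ x ∧ b ≠ x
  symm := ⟨fun _ _ h => ⟨h.1.symm, h.2.2, h.2.1⟩⟩
  loopless := ⟨fun _ h => H.irrefl h.1⟩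

section Isolate

variable {σ : Type*} {H : SimpleGraph σ} {x : σ}

theorem SimpleGraph.isolate_le : H.isolate x ≤ H := fun _ _ h => h.1

theorem SimpleGraph.ncard_edgeSet_isolate_lt [Finite σ] {y : σ} (h : H.Adj x y) :
    (H.isolate x).edgeSet.ncard < H.edgeSet.ncard := by
  refine Set.ncard_lt_ncard ?_ (Set.toFinite _)
  refine ⟨SimpleGraph.edgeSet_mono isolate_le, fun hle => ?_⟩
  have : (H.isolate x).Adj x y := hle (show s(x, y) ∈ H.edgeSet from h)
  exact this.2.1 rfl

theorem EdgePow.isolate {k : ℕ} {s : σ →₀ ℕ} (h : EdgePow H k s) (hs : s x = 0) :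
    EdgePow (H.isolate x) k s :=
  h.of_adj fun _ _ hab ha hb =>
    ⟨hab, fun hax => ha (hax ▸ hs), fun hbx => hb (hbx ▸ hs)⟩

end Isolate

/-- A forest `H` whose vertices are partly removed (those in `A`), where the remaining graph is
made of a core `C` and of leaves attached to the core: every core vertex is isolated or carries at
least one such leaf. Acyclicity is replaced by the property that each nonempty set of core vertices
contains a vertex with at most one neighbour in this set. -/
structure IsWhiskered {σ : Type*} (H : SimpleGraph σ) (A : Set σ) (C : Finset σ) : Prop where
  core_notMem : ∀ c ∈ C, c ∉ A
  isolated : ∀ a ∈ A, ∀ b, ¬ H.Adj a b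
  unique : ∀ w ∉ C, ∀ a b, H.Adj w a → H.Adj w b → a = b
  nbr_mem : ∀ w ∉ C, ∀ a, H.Adj w a → a ∈ C
  exists_whisker : ∀ c ∈ C, ∀ a, H.Adj c a → ∃ w, w ∉ C ∧ H.Adj c w
  degenerate : ∀ U ⊆ C, U.Nonempty →
    ∃ u ∈ U, ∀ a ∈ U, ∀ b ∈ U, H.Adj u a → H.Adj u b → a = b

namespace IsWhiskered

variable {σ : Type*} {H : SimpleGraph σ} {A : Set σ} {C : Finset σ} {n m y : σ}

/-- Only `n` can lose a whisker with `y`. By `hn` it keeps another one or becomes isolated, so the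
core need not change. -/
theorem isolate_whisker (h : IsWhiskered H A C) (hy : y ∉ C) (hny : H.Adj n y)
    (hn : (∃ w, w ∉ C ∧ w ≠ y ∧ H.Adj n w) ∨ ∀ a, H.Adj n a → a = y) :
    IsWhiskered (H.isolate y) (insert y A) C where
  core_notMem c hc := by
    rintro (rfl | hcA)
    · exact hy hc
    · exact h.core_notMem c hc hcA
  isolated := by
    rintro a (rfl | ha) b hab
    · exact hab.2.1 rfl
    · exact h.isolated a ha b hab.1
  unique w hw a b ha hb := h.unique w hw a b ha.1 hb.1
  nbr_mem w hw a ha := h.nbr_mem w hw a ha.1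
  exists_whisker c hc a ha := by
    have hcy : c ≠ y := ha.2.1
    by_cases hcn : c = n
    · subst hcn
      rcases hn with ⟨w, hw, hwy, hcw⟩ | hn
      · exact ⟨w, hw, hcw, hcy, hwy⟩
      · exact absurd (hn a ha.1) ha.2.2
    · obtain ⟨w, hw, hcw⟩ := h.exists_whisker c hc a ha.1
      refine ⟨w, hw, hcw, hcy, ?_⟩
      rintro rfl
      exact hcn (h.unique w hw _ _ hcw.symm hny.symm)
  degenerate U hU hne := by
    obtain ⟨u, hu, hu'⟩ := h.degenerate U hU hne
    exact ⟨u, hu, fun a ha b hb hua hub => hu' a ha b hb hua.1 hub.1⟩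

theorem card_erase_union [DecidableEq σ] (hn : n ∈ C) (Y : Finset σ) (hY : ∀ y ∈ Y, y ∉ C) :
    (C.erase n ∪ Y).card + 1 = C.card + Y.card := by
  rw [Finset.card_union_of_disjoint, ← Finset.card_erase_add_one hn]
  · omega
  · exact Finset.disjoint_left.2 fun c hc hcY => hY c hcY (Finset.mem_of_mem_erase hc)

/-- Unless there are no edges, some core vertex has a whisker and at most one neighbour in the
core. -/
theorem exists_core_leaf (h : IsWhiskered H A C) {a b : σ} (hab : H.Adj a b) :
    ∃ n ∈ C, ∃ y, y ∉ C ∧ H.Adj n y ∧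
      ∀ c ∈ C, ∀ d ∈ C, H.Adj n c → H.Adj n d → c = d := by
  classical
  -- Degeneracy is applied to the non-isolated core vertices: these carry whiskers, and every core
  -- neighbour of such a vertex is again non-isolated.
  have hne : (C.filter fun c => ∃ d, H.Adj c d).Nonempty := by
    by_cases ha : a ∈ C
    · exact ⟨a, Finset.mem_filter.2 ⟨ha, b, hab⟩⟩
    · exact ⟨b, Finset.mem_filter.2 ⟨h.nbr_mem a ha b hab, a, hab.symm⟩⟩
  obtain ⟨n, hn, hn'⟩ := h.degenerate _ (Finset.filter_subset _ _) hne
  obtain ⟨hnC, d, hnd⟩ := Finset.mem_filter.1 hn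
  obtain ⟨y, hy, hny⟩ := h.exists_whisker n hnC d hnd
  exact ⟨n, hnC, y, hy, hny, fun c hc d hd hnc hnd => hn' c (Finset.mem_filter.2 ⟨hc, n, hnc.symm⟩)
    d (Finset.mem_filter.2 ⟨hd, n, hnd.symm⟩) hnc hnd⟩

variable [DecidableEq σ]

/-- If `y` is the only whisker at `n`, and `n` has a single further neighbour `m`, then `n` becomes
a whisker at `m` after the removal of `y`. -/
theorem isolate_whisker_erase (h : IsWhiskered H A C) (hy : y ∉ C) (hny : H.Adj n y)
    (hm : m ∈ C) (hnm : H.Adj n m) (hn : ∀ a, H.Adj n a → a = y ∨ a = m) :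
    IsWhiskered (H.isolate y) (insert y A) (C.erase n) where
  core_notMem c hc := by
    rintro (rfl | hcA)
    · exact hy (Finset.mem_of_mem_erase hc)
    · exact h.core_notMem c (Finset.mem_of_mem_erase hc) hcA
  isolated := by
    rintro a (rfl | ha) b hab
    · exact hab.2.1 rfl
    · exact h.isolated a ha b hab.1
  unique w hw a b ha hb := by
    by_cases hwn : w = n
    · subst hwn
      rw [(hn a ha.1).resolve_left ha.2.2, (hn b hb.1).resolve_left hb.2.2]
    · exact h.unique w (fun hwC => hw (Finset.mem_erase.2 ⟨hwn, hwC⟩)) a b ha.1 hb.1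
  nbr_mem w hw a ha := by
    by_cases hwn : w = n
    · subst hwn
      rw [(hn a ha.1).resolve_left ha.2.2]
      exact Finset.mem_erase.2 ⟨hnm.ne', hm⟩
    · have hwC : w ∉ C := fun hwC => hw (Finset.mem_erase.2 ⟨hwn, hwC⟩)
      refine Finset.mem_erase.2 ⟨?_, h.nbr_mem w hwC a ha.1⟩
      rintro rfl
      rcases hn w ha.1.symm with rfl | rfl
      · exact ha.2.1 rfl
      · exact hwC hm
  exists_whisker c hc a ha := by
    have hcn := Finset.ne_of_mem_erase hc
    obtain ⟨w, hw, hcw⟩ := h.exists_whisker c (Finset.mem_of_mem_erase hc) a ha.1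
    refine ⟨w, fun hw' => hw (Finset.mem_of_mem_erase hw'), hcw, ha.2.1, ?_⟩
    rintro rfl
    exact hcn (h.unique w hw _ _ hcw.symm hny.symm)
  degenerate U hU hne := by
    obtain ⟨u, hu, hu'⟩ := h.degenerate U (hU.trans (Finset.erase_subset _ _)) hne
    exact ⟨u, hu, fun a ha b hb hua hub => hu' a ha b hb hua.1 hub.1⟩

/-- If a core vertex `n` is removed, then its whiskers become isolated, and can replace it in the
core. -/
theorem isolate_core (h : IsWhiskered H A C) (hn : n ∈ C) (Y : Finset σ)
    (hY : ∀ y ∈ Y, y ∉ C ∧ H.Adj n y) :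
    IsWhiskered (H.isolate n) (insert n A) (C.erase n ∪ Y) := by
  have hYiso : ∀ y ∈ Y, ∀ a, ¬ (H.isolate n).Adj y a := fun y hy a ha =>
    ha.2.2 (h.unique y (hY y hy).1 _ _ ha.1 (hY y hy).2.symm)
  have hnotMem : ∀ w, w ∉ C.erase n ∪ Y → w ≠ n → w ∉ C := fun w hw hwn hwC =>
    hw (Finset.mem_union_left _ (Finset.mem_erase.2 ⟨hwn, hwC⟩))
  refine ⟨?_, ?_, ?_, ?_, ?_, ?_⟩
  · intro c hc
    rcases Finset.mem_union.1 hc with hc | hc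
    · rintro (rfl | hcA)
      · exact Finset.ne_of_mem_erase hc rfl
      · exact h.core_notMem c (Finset.mem_of_mem_erase hc) hcA
    · obtain ⟨hcC, hnc⟩ := hY c hc
      rintro (rfl | hcA)
      · exact hcC hn
      · exact h.isolated c hcA n hnc.symm
  · rintro a (rfl | ha) b hab
    · exact hab.2.1 rfl
    · exact h.isolated a ha b hab.1
  · exact fun w hw a b ha hb => h.unique w (hnotMem w hw ha.2.1) a b ha.1 hb.1
  · exact fun w hw a ha => Finset.mem_union_left _
      (Finset.mem_erase.2 ⟨ha.2.2, h.nbr_mem w (hnotMem w hw ha.2.1) a ha.1⟩)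
  · intro c hc a ha
    have hcC : c ∈ C := by
      rcases Finset.mem_union.1 hc with hc | hc
      · exact Finset.mem_of_mem_erase hc
      · exact absurd ha (hYiso c hc a)
    obtain ⟨w, hw, hcw⟩ := h.exists_whisker c hcC a ha.1
    refine ⟨w, ?_, hcw, ha.2.1, fun hwn => hw (hwn ▸ hn)⟩
    -- A whisker of `c` lying in `Y` would be adjacent to both `c` and `n`, which `unique` forbids.
    intro hw'
    rcases Finset.mem_union.1 hw' with hw' | hw'
    · exact hw (Finset.mem_of_mem_erase hw')
    · exact ha.2.1 (h.unique w hw _ _ hcw.symm (hY w hw').2.symm)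
  · intro U hU hne
    by_cases hUY : ∃ y ∈ Y, y ∈ U
    · obtain ⟨y, hy, hyU⟩ := hUY
      exact ⟨y, hyU, fun a _ b _ ha _ => absurd ha (hYiso y hy a)⟩
    · have hUC : U ⊆ C := fun u hu => by
        rcases Finset.mem_union.1 (hU hu) with h' | h'
        · exact Finset.mem_of_mem_erase h'
        · exact absurd ⟨u, h', hu⟩ hUY
      obtain ⟨u, hu, hu'⟩ := h.degenerate U hUC hne
      exact ⟨u, hu, fun a ha b hb hua hub => hu' a ha b hb hua.1 hub.1⟩

end IsWhiskered

/-! ### Colons and sums of the ideals in the induction -/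

/-- The exponent vectors of the monomials in `I(H)^k + (x_a : a ∈ A)`. -/
def powExponents {σ : Type*} (H : SimpleGraph σ) (k : ℕ) (A : Set σ) : Set (σ →₀ ℕ) :=
  {s | EdgePow H k s ∨ ∃ a ∈ A, s a ≠ 0}

section PowExponents

open Finsupp

variable {σ : Type*} {H : SimpleGraph σ} {A : Set σ} {k : ℕ} {n y : σ}

theorem isUpperSet_powExponents : IsUpperSet (powExponents H k A) :=
  EdgePow.isUpperSet.union (isUpperSet_setOf_exists_ne_zero A)

theorem exists_add_single_ne_zero_iff {x : σ} (hx : x ∉ A) (s : σ →₀ ℕ) :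
    (∃ a ∈ A, (s + single x 1 : σ →₀ ℕ) a ≠ 0) ↔ ∃ a ∈ A, s a ≠ 0 := by
  refine exists_congr fun a => and_congr_right fun ha => ?_
  have : a ≠ x := by rintro rfl; exact hx ha
  simp [single_eq_of_ne this]

theorem mem_Ici_single {x : σ} {s : σ →₀ ℕ} : s ∈ Set.Ici (single x 1) ↔ s x ≠ 0 := by
  simp [Nat.one_le_iff_ne_zero]

theorem powExponents_colon_leaf (hn : n ∉ A) (hyA : y ∉ A) (hy : ∀ a, H.Adj y a → a = n)
    (hny : H.Adj n y) :
    {s | s + (single n 1 + single y 1) ∈ powExponents H (k + 1) A} = powExponents H k A := by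
  ext s
  refine or_congr ⟨EdgePow.of_add_leaf hy hny, EdgePow.succ hny⟩ ?_
  rw [← add_assoc, exists_add_single_ne_zero_iff hyA, exists_add_single_ne_zero_iff hn]

/-- Modulo `x` only monomials free of `x` matter, and these use no edge at `x`. -/
theorem powExponents_union_Ici (x : σ) :
    powExponents H k A ∪ Set.Ici (single x 1) = powExponents (H.isolate x) k (insert x A) := by
  ext s
  simp only [powExponents, Set.mem_union, mem_Ici_single, Set.mem_ofPred_eq, Set.exists_mem_insert]
  constructor
  · rintro ((h | h) | h)
    · by_cases hs : s x = 0
      · exact Or.inl (h.isolate hs)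
      · exact Or.inr (Or.inl hs)
    · exact Or.inr (Or.inr h)
    · exact Or.inr (Or.inl h)
  · rintro (h | h | h)
    · exact Or.inl (Or.inl (h.mono SimpleGraph.isolate_le))
    · exact Or.inr h
    · exact Or.inl (Or.inr h)

theorem union_Ici_add_union_Ici_left (T : Set (σ →₀ ℕ)) (e f : σ →₀ ℕ) :
    T ∪ Set.Ici (e + f) ∪ Set.Ici e = T ∪ Set.Ici e := by
  rw [Set.union_assoc, Set.union_eq_right.2 (Set.Ici_subset_Ici.2 le_self_add)]

theorem union_Ici_add_union_Ici_right (T : Set (σ →₀ ℕ)) (e f : σ →₀ ℕ) :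
    T ∪ Set.Ici (e + f) ∪ Set.Ici f = T ∪ Set.Ici f := by
  rw [add_comm, union_Ici_add_union_Ici_left]

/-- `(I^k + (x_n y)) : y = I(H - n)^k + (x_n)` for a leaf `y` at `n`. -/
theorem powExponents_union_colon_leaf (hyA : y ∉ A) (hy : ∀ a, H.Adj y a → a = n)
    (hne : n ≠ y) :
    {s | s + single y 1 ∈ powExponents H k A ∪ Set.Ici (single n 1 + single y 1)} =
      powExponents (H.isolate n) k (insert n A) := by
  ext s
  have hIci : s + single y 1 ∈ Set.Ici (single n 1 + single y 1) ↔ s n ≠ 0 := by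
    rw [Set.mem_Ici, add_le_add_iff_right, ← Set.mem_Ici, mem_Ici_single]
  simp only [powExponents, Set.mem_union, hIci, Set.mem_ofPred_eq, Set.exists_mem_insert,
    exists_add_single_ne_zero_iff hyA]
  have hiso : ∀ a, ¬ (H.isolate n).Adj y a := fun a ha => ha.2.2 (hy a ha.1)
  constructor
  · rintro ((h | h) | h)
    · by_cases hs : s n = 0
      · refine Or.inl (EdgePow.of_add_single_of_isolated hiso (h.isolate ?_))
        simp [hs, single_eq_of_ne hne]
      · exact Or.inr (Or.inl hs)
    · exact Or.inr (Or.inr h)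
    · exact Or.inr (Or.inl h)
  · rintro (h | h | h)
    · exact Or.inl (Or.inl ((h.mono SimpleGraph.isolate_le).add_right _))
    · exact Or.inr h
    · exact Or.inl (Or.inr h)

/-- `(I^k + (x_n y)) : x_n = (I(H - y)^k : x_n) + (y)` for a leaf `y` at `n`. -/
theorem powExponents_union_colon_core (hne : n ≠ y) :
    {s | s + single n 1 ∈ powExponents H k A ∪ Set.Ici (single n 1 + single y 1)} =
      {s | s + single n 1 ∈ powExponents (H.isolate y) k (insert y A)} := by
  ext s
  have hIci : s + single n 1 ∈ Set.Ici (single n 1 + single y 1) ↔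
      s + single n 1 ∈ Set.Ici (single y 1) := by
    rw [add_comm (single n 1), Set.mem_Ici, add_le_add_iff_right, ← Set.mem_Ici, mem_Ici_single,
      mem_Ici_single]
    simp [single_eq_of_ne hne.symm]
  rw [← powExponents_union_Ici]
  exact or_congr Iff.rfl hIci

theorem powExponents_colon_isolated {x : σ} (hxA : x ∉ A) (hx : ∀ a, ¬ H.Adj x a) :
    {s | s + single x 1 ∈ powExponents H k A} = powExponents H k A := by
  ext s
  exact or_congr ⟨EdgePow.of_add_single_of_isolated hx, fun h => h.add_right _⟩
    (exists_add_single_ne_zero_iff hxA s)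

/-- Once `x_m` is added, `n` has lost its only possible neighbour, so the colon by `x_n` has no
effect. -/
theorem powExponents_colon_union_Ici {m : σ} (hn : n ∉ A) (hnm : n ≠ m)
    (h : ∀ a, H.Adj n a → a = m) :
    {s | s + single n 1 ∈ powExponents H k A} ∪ Set.Ici (single m 1) =
      powExponents (H.isolate m) k (insert m A) := by
  have hn' : n ∉ insert m A := by
    rintro (rfl | hnA)
    · exact hnm rfl
    · exact hn hnA
  rw [← powExponents_colon_isolated (H := H.isolate m) hn' fun a ha => ha.2.2 (h a ha.1),
    ← powExponents_union_Ici]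
  ext s
  refine or_congr Iff.rfl ?_
  rw [mem_Ici_single, mem_Ici_single]
  simp [single_eq_of_ne hnm.symm]

theorem powExponents_zero : powExponents H 0 A = Set.univ :=
  Set.eq_univ_of_forall fun s => Or.inl (.zero s)

theorem powExponents_of_no_edges (hk : k ≠ 0) (h : ∀ a b, ¬ H.Adj a b) :
    powExponents H k A = {s | ∃ a ∈ A, s a ≠ 0} := by
  ext s
  refine or_iff_right fun hs => ?_
  cases hs with
  | zero => exact hk rfl
  | succ hab _ => exact h _ _ hab

end PowExponents

/-! ### The inductive depth bound -/

open MvPolynomial Finsupp in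
/-- The depth bound for the powers of the edge ideal of a partly whiskered forest. -/
theorem IsWhiskered.extVanishes {σ : Type*} [Finite σ] (K : Type*) [Field K] (H : SimpleGraph σ)
    (A : Set σ) (C : Finset σ) (h : IsWhiskered H A C) (k : ℕ) :
    ExtVanishes (idealOfVars σ K) (monomialIdeal K (powExponents H k A)) (C.card + 1 - k) := by
  classical
  induction hN : H.edgeSet.ncard + k using Nat.strong_induction_on generalizing H A C k with
  | _ N ih =>
  subst hN
  rcases Nat.eq_zero_or_pos k with rfl | hk
  · have : monomialIdeal K (powExponents H 0 A) = ⊤ := by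
      rw [powExponents_zero, Ideal.eq_top_iff_one]
      exact Ideal.subset_span ⟨0, trivial, rfl⟩
    rw [this]
    exact .top
  by_cases hedge : ∀ a b, ¬ H.Adj a b
  · rw [powExponents_of_no_edges hk.ne' hedge]
    exact (extVanishes_variables C A h.core_notMem).mono (by omega)
  push Not at hedge
  obtain ⟨a, b, hab⟩ := hedge
  obtain ⟨n, hn, y, hy, hny, hleaf⟩ := h.exists_core_leaf hab
  obtain ⟨k, rfl⟩ : ∃ l, k = l + 1 := ⟨k - 1, by omega⟩
  have hnA : n ∉ A := h.core_notMem n hn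
  have hyA : y ∉ A := fun hyA => h.isolated y hyA n hny.symm
  have hyn : ∀ a, H.Adj y a → a = n := fun a ha => h.unique y hy _ _ ha hny.symm
  have hlt_n := SimpleGraph.ncard_edgeSet_isolate_lt hny
  have hlt_y := SimpleGraph.ncard_edgeSet_isolate_lt hny.symm
  refine ExtVanishes.monomial_of_colon isUpperSet_powExponents _
    (powExponents_colon_leaf hnA hyA hyn hny) rfl
    ((ih _ (by omega) H A C h k rfl).mono (by omega)) ?_
  have hup : IsUpperSet (powExponents H (k + 1) A ∪ Set.Ici (single n 1 + single y 1)) :=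
    isUpperSet_powExponents.union (isUpperSet_Ici _)
  -- The leaf `y`, isolated once `n` is deleted, replaces `n` in the core, whose size is unchanged.
  have hdel_n : ExtVanishes (idealOfVars σ K)
      (monomialIdeal K (powExponents (H.isolate n) (k + 1) (insert n A))) (C.card + 1 - (k + 1)) := by
    have hcard := IsWhiskered.card_erase_union hn {y} (by simpa using hy)
    refine (ih _ (by omega) _ _ _ (h.isolate_core hn {y} (by simpa using ⟨hy, hny⟩)) _ rfl).mono ?_
    rw [Finset.card_singleton] at hcard
    omega
  have hdel_y (hw : (∃ w, w ∉ C ∧ w ≠ y ∧ H.Adj n w) ∨ ∀ a, H.Adj n a → a = y) :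
      ExtVanishes (idealOfVars σ K)
        (monomialIdeal K (powExponents (H.isolate y) (k + 1) (insert y A)))
        (C.card + 1 - (k + 1)) :=
    ih _ (by omega) _ _ _ (h.isolate_whisker hy hny hw) _ rfl
  by_cases hw : ∃ w, w ∉ C ∧ w ≠ y ∧ H.Adj n w
  -- With a second whisker at `n`, splitting along `y` leaves just the two deletions.
  · refine ExtVanishes.monomial_of_colon hup (single y 1)
      (powExponents_union_colon_leaf hyA hyn hny.ne) ?_ hdel_n (hdel_y (Or.inl hw))
    rw [union_Ici_add_union_Ici_right, powExponents_union_Ici]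
  have hnbr : ∀ a, H.Adj n a → a ∉ C → a = y := fun a ha haC =>
    by_contra fun hay => hw ⟨a, haC, hay, ha⟩
  -- Here `y` is the only whisker at `n`. Splitting along `x_n` leaves, besides the deletion of `n`,
  -- the ideal `(I(H - y)^k : x_n) + (y)` together with the variables in `A`.
  refine ExtVanishes.monomial_of_colon hup (single n 1)
    (powExponents_union_colon_core hny.ne)
    (by rw [union_Ici_add_union_Ici_left, powExponents_union_Ici]) ?_ hdel_n
  have hnA' : n ∉ insert y A := by
    rintro (hny' | hnA')
    · exact hny.ne hny'
    · exact hnA hnA'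
  by_cases hm : ∃ m ∈ C, H.Adj n m
  · obtain ⟨m, hmC, hnm⟩ := hm
    have hmA : m ∉ insert y A := by
      rintro (rfl | hmA)
      · exact hy hmC
      · exact h.core_notMem m hmC hmA
    have hmy : m ≠ y := fun hmy => hy (hmy ▸ hmC)
    have hnbr' : ∀ a, H.Adj n a → a = y ∨ a = m := fun a ha => by
      by_cases haC : a ∈ C
      · exact Or.inr (hleaf a haC m hmC ha hnm)
      · exact Or.inl (hnbr a ha haC)
    have hn_leaf : ∀ a, (H.isolate y).Adj n a → a = m := fun a ha =>
      (hnbr' a ha.1).resolve_left ha.2.2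
    have hmn' : (H.isolate y).Adj m n := ⟨hnm.symm, hmy, hny.ne⟩
    have hW := h.isolate_whisker_erase hy hny hmC hnm hnbr'
    have hcard := Finset.card_erase_add_one hn
    -- In `H - y` the vertex `n` is a leaf at `m`, so the colon by `x_m` cancels the edge `{n, m}`.
    -- The core shrinks by one, and so does the exponent.
    refine ExtVanishes.monomial_of_colon (isUpperSet_setOf_add_mem isUpperSet_powExponents _)
      (single m 1) (T₁ := powExponents (H.isolate y) k (insert y A)) ?_
      (powExponents_colon_union_Ici hnA' hnm.ne hn_leaf) ?_ ?_
    · refine Eq.trans ?_ (powExponents_colon_leaf hmA hnA' hn_leaf hmn')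
      simp only [Set.mem_ofPred_eq, add_assoc]
    · exact (ih _ (by omega) _ _ _ hW k rfl).mono (by omega)
    -- Adding `x_m` deletes `m`. It frees two leaves, `n` and the original whisker `z`, which make
    -- up for the loss of both `n` and `m` from the core.
    · obtain ⟨z, hz, hmz⟩ := h.exists_whisker m hmC n hnm.symm
      have hzn : z ≠ n := fun hzn => hz (hzn ▸ hn)
      have hzy : z ≠ y := by
        rintro rfl
        exact hnm.ne (hyn m hmz.symm).symm
      have hmC' : m ∈ C.erase n := Finset.mem_erase.2 ⟨hnm.ne', hmC⟩
      have hY : ∀ w ∈ ({n, z} : Finset σ), w ∉ C.erase n ∧ (H.isolate y).Adj m w := by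
        intro w hw
        rcases Finset.mem_insert.1 hw with rfl | hw
        · exact ⟨Finset.notMem_erase _ _, hmn'⟩
        · obtain rfl := Finset.mem_singleton.1 hw
          exact ⟨fun hzC => hz (Finset.mem_of_mem_erase hzC), hmz, hmy, hzy⟩
      have hcard' := IsWhiskered.card_erase_union hmC' {n, z} fun w hw => (hY w hw).1
      rw [Finset.card_pair hzn.symm] at hcard'
      have hlt_m := SimpleGraph.ncard_edgeSet_isolate_lt hmn'
      exact (ih _ (by omega) _ _ _ (hW.isolate_core hmC' _ hY) _ rfl).mono (by omega)
  · have hn_only : ∀ a, H.Adj n a → a = y := fun a ha =>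
      hnbr a ha fun haC => hm ⟨a, haC, ha⟩
    rw [powExponents_colon_isolated (H := H.isolate y) hnA' fun a ha => ha.2.2 (hn_only a ha.1)]
    exact hdel_y (Or.inr hn_only)

/-! ### Forests, whisker graphs and the conclusion -/

/-- Every nonempty set of vertices of a finite forest contains a vertex with at most one neighbour
in this set. -/
theorem SimpleGraph.IsAcyclic.exists_mem_subsingleton_neighbors {V : Type*} [Finite V]
    {G : SimpleGraph V} (hG : G.IsAcyclic) (U : Set V) (hU : U.Nonempty) :
    ∃ u ∈ U, ∀ a ∈ U, ∀ b ∈ U, G.Adj u a → G.Adj u b → a = b := by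
  classical
  have := Fintype.ofFinite V
  let S : Set ℕ := {l | ∃ (u v : V) (p : G.Walk u v), p.IsPath ∧ (∀ w ∈ p.support, w ∈ U) ∧
    p.length = l}
  have hS : S.Nonempty := by
    obtain ⟨u, hu⟩ := hU
    exact ⟨0, u, u, .nil, .nil, by simpa using hu, rfl⟩
  have hbdd : BddAbove S := by
    refine ⟨Fintype.card V, ?_⟩
    rintro _ ⟨u, v, p, hp, -, rfl⟩
    exact hp.length_lt.le
  obtain ⟨u, v, p, hp, hpU, hlen⟩ := Nat.sSup_mem hS hbdd
  -- At the start of a longest path inside `U`, a neighbour in `U` off the path would lengthen it,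
  -- and acyclicity forces one on the path to be its second vertex.
  have key : ∀ w ∈ U, G.Adj u w → w = p.snd := by
    intro w hw huw
    refine hG.eq_snd_of_adj_start hp huw (by_contra fun hwp => ?_)
    have : p.length + 1 ≤ sSup S := le_csSup hbdd
      ⟨w, v, .cons huw.symm p, hp.cons hwp, by simpa using ⟨hw, hpU⟩, rfl⟩
    omega
  exact ⟨u, hpU u p.start_mem_support, fun a ha b hb hua hub =>
    (key a ha hua).trans (key b hb hub).symm⟩

theorem isWhiskered_whiskerGraph {V : Type*} [Fintype V] {G : SimpleGraph V} (hG : G.IsAcyclic) :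
    IsWhiskered (whiskerGraph G) ∅ (Finset.univ.map Function.Embedding.inl) where
  core_notMem _ _ := Set.notMem_empty _
  isolated _ ha := absurd ha (Set.notMem_empty _)
  unique := by
    rintro (w | w) hw (a | a) (b | b) ha hb
    · simp at hw
    · simp at hw
    · simp at hw
    · simp at hw
    · exact congrArg Sum.inl ((show a = w from ha.symm).trans (show w = b from hb.symm ▸ rfl))
    · exact hb.elim
    · exact ha.elim
    · exact ha.elim
  nbr_mem := by
    rintro (w | w) hw (a | a) ha
    · simp
    · simp at hw
    · simp
    · exact ha.elim
  exists_whisker := by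
    rintro (c | c) hc a _
    · exact ⟨Sum.inr c, by simp, rfl⟩
    · simp at hc
  degenerate U hU hne := by
    have hinl : ∀ x ∈ U, ∃ v, Sum.inl v = x := fun x hx => by simpa using hU hx
    obtain ⟨u, hu, hu'⟩ := hG.exists_mem_subsingleton_neighbors {v | Sum.inl v ∈ U} (by
      obtain ⟨x, hx⟩ := hne
      obtain ⟨v, rfl⟩ := hinl x hx
      exact ⟨v, hx⟩)
    refine ⟨Sum.inl u, hu, fun a ha b hb hua hub => ?_⟩
    obtain ⟨a, rfl⟩ := hinl a ha
    obtain ⟨b, rfl⟩ := hinl b hb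
    exact congrArg Sum.inl (hu' a ha b hb hua hub)

theorem edgeIdeal_le_idealOfVars (K : Type*) [Field K] {σ : Type*} (H : SimpleGraph σ) :
    edgeIdeal K H ≤ MvPolynomial.idealOfVars σ K := by
  rw [edgeIdeal, Ideal.span_le]
  rintro _ ⟨a, b, -, rfl⟩
  exact Ideal.mul_mem_right _ _ (Ideal.subset_span ⟨a, rfl⟩)

theorem idealOfVars_ne_top (K σ : Type*) [Field K] : MvPolynomial.idealOfVars σ K ≠ ⊤ := by
  intro h
  have h1 := (Ideal.eq_top_iff_one _).1 h
  rw [← pow_one (MvPolynomial.idealOfVars σ K), ← map_one MvPolynomial.C,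
    MvPolynomial.C_mem_pow_idealOfVars_iff] at h1
  simp at h1

theorem theorem2p5 {V : Type*} [Fintype V] (K : Type*) [Field K] (G : SimpleGraph V)
    (hG : G.IsAcyclic) (n : ℕ) (hn : Fintype.card V = n) (k : ℕ) (hk1 : 1 ≤ k) (hkn : k ≤ n) :
    ((n - k + 1 : ℕ) : ℕ∞) ≤
      moduleDepth (MvPolynomial.idealOfVars (V ⊕ V) K)
        (MvPolynomial (V ⊕ V) K ⧸ edgeIdeal K (whiskerGraph G) ^ k) := by
  refine ExtVanishes.le_moduleDepth (idealOfVars_ne_top K _)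
    ((Ideal.pow_le_self (by omega)).trans (edgeIdeal_le_idealOfVars K _)) ?_
  have h := (isWhiskered_whiskerGraph hG).extVanishes K _ _ _ k
  rw [Finset.card_map, Finset.card_univ, hn] at h
  have hset : powExponents (whiskerGraph G) k ∅ = {s | EdgePow (whiskerGraph G) k s} := by
    ext s
    simp [powExponents]
  rw [hset, ← edgeIdeal_pow] at h
  -- The truncated differences `n - k + 1` and `n + 1 - k` agree only because `k ≤ n`.
  exact h.mono (by omega)
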